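/- For $A,B,C\in\mathrm{SL}(3,\mathbb C)$ with $CBA=I$, define the shape invariants $$\sigma_+(A,B,C)=\operatorname{tr}(A^{-1}B)-\operatorname{tr}(A^{-1})\operatorname{tr}(B),\qquad \sigma_-(A,B,C)=\operatorname{tr}(B^{-1}A)-\operatorname{tr}(B^{-1})\operatorname{tr}(A),$$ and write $[A,B]=ABA^{-1}B^{-1}$. Let $\Phi_*:\mathrm{SL}(2,\mathbb C)\to\mathrm{SL}(3,\mathbb C)$ be the irreducible representation $$\Phi_*\begin{pmatrix} a&b\\ c&d\end{pmatrix}=\begin{pmatrix} a^2&-\sqrt2\,ab&-b^2\\ -\sqrt2\,ac&ad+bc&\sqrt2\,bd\\ -c^2&\sqrt2\,cd&d^2\end{pmatrix}.$$ A subgroup of $\mathrm{SL}(3,\mathbb C)$ is called reducible if it leaves invariant a complex linear subspace of $\mathbb C^3$ other than $0$ and $\mathbb C^3$. Suppose that $A,B,C\in\mathrm{SL}(3,\mathbb C)$ satisfy $CBA=I$ and $$\operatorname{tr}(A)=\operatorname{tr}(A^{-1}),\quad \operatorname{tr}(B)=\operatorname{tr}(B^{-1}),\quad \operatorname{tr}(C)=\operatorname{tr}(C^{-1}),$$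 $$\sigma_+(A,B,C)=\sigma_-(A,B,C),\quad \operatorname{tr}[A,B]=\operatorname{tr}\bigl([A,B]^{-1}\bigr).$$ Then the subgroup $\langle A,B,C\rangle$ of $\mathrm{SL}(3,\mathbb C)$ is reducible, or there is $D\in\mathrm{SL}(3,\mathbb C)$ such that $D\langle A,B,C\rangle D^{-1}$ is contained in the image of $\Phi_*$. -/

import Mathlib

open scoped Matrix MatrixGroups

namespace ShapeInvariants

noncomputable section

/-- The trace of an element of `SL(n, ℂ)`. -/
def tr {n : ℕ} (A : SL(n, ℂ)) : ℂ :=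
  (A : Matrix (Fin n) (Fin n) ℂ).trace

/-- The shape invariant `σ₊ = tr(A⁻¹B) - tr(A⁻¹) tr(B)` of a triple `A, B, C` with `CBA = I`
(`C` is determined by `A` and `B`). -/
def shapePlus (A B _C : SL(3, ℂ)) : ℂ :=
  tr (A⁻¹ * B) - tr A⁻¹ * tr B

/-- The shape invariant `σ₋ = tr(B⁻¹A) - tr(B⁻¹) tr(A)` of a triple `A, B, C` with `CBA = I`
(`C` is determined by `A` and `B`). -/
def shapeMinus (A B _C : SL(3, ℂ)) : ℂ :=
  tr (B⁻¹ * A) - tr B⁻¹ * tr A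

/-- A subgroup `Γ` of `SL(3, ℂ)` is reducible if its action on column vectors leaves invariant
a complex linear subspace of `ℂ³` other than `0` and `ℂ³`. -/
def IsReducible (Γ : Subgroup SL(3, ℂ)) : Prop :=
  ∃ W : Submodule ℂ (Fin 3 → ℂ), W ≠ ⊥ ∧ W ≠ ⊤ ∧
    ∀ g ∈ Γ, ∀ v ∈ W, (g : Matrix (Fin 3) (Fin 3) ℂ) *ᵥ v ∈ W

/-- The matrix of `Φ_*(M)`. -/
def phiStarMatrix (M : Matrix (Fin 2) (Fin 2) ℂ) : Matrix (Fin 3) (Fin 3) ℂ :=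
  let s : ℂ := (Real.sqrt 2 : ℝ)
  let a := M 0 0
  let b := M 0 1
  let c := M 1 0
  let d := M 1 1
  !![a ^ 2,      -s * a * b,     -b ^ 2;
     -s * a * c,  a * d + b * c,  s * b * d;
     -c ^ 2,      s * c * d,      d ^ 2]

theorem sqrt_two_mul_self : ((Real.sqrt 2 : ℝ) : ℂ) * ((Real.sqrt 2 : ℝ) : ℂ) = 2 := by
  rw [← Complex.ofReal_mul, Real.mul_self_sqrt (by norm_num)]
  norm_num

theorem phiStarMatrix_det (M : SL(2, ℂ)) :
    (phiStarMatrix (M : Matrix (Fin 2) (Fin 2) ℂ)).det = 1 := by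
  have hd := M.det_coe
  rw [Matrix.det_fin_two] at hd
  have hs := sqrt_two_mul_self
  simp only [phiStarMatrix, Matrix.det_fin_three, Matrix.of_apply, Matrix.cons_val', Matrix.cons_val]
  generalize ((Real.sqrt 2 : ℝ) : ℂ) = s at *
  generalize (M : Matrix (Fin 2) (Fin 2) ℂ) 0 0 = a at *
  generalize (M : Matrix (Fin 2) (Fin 2) ℂ) 0 1 = b at *
  generalize (M : Matrix (Fin 2) (Fin 2) ℂ) 1 0 = c at *
  generalize (M : Matrix (Fin 2) (Fin 2) ℂ) 1 1 = d at *
  have h3 : (a * d - b * c) ^ 3 = 1 := by rw [hd]; ring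
  linear_combination h3 + (-2 * a ^ 2 * b * c * d ^ 2 + 2 * a * b ^ 2 * c ^ 2 * d) * hs

theorem phiStarMatrix_mul (M N : Matrix (Fin 2) (Fin 2) ℂ) :
    phiStarMatrix (M * N) = phiStarMatrix M * phiStarMatrix N := by
  have hs := sqrt_two_mul_self
  ext i j
  fin_cases i <;> fin_cases j <;>
    simp [phiStarMatrix, Matrix.mul_apply, Fin.sum_univ_succ] <;>
    generalize ((Real.sqrt 2 : ℝ) : ℂ) = s at * <;>
    grind

theorem phiStarMatrix_one : phiStarMatrix 1 = 1 := by
  ext i j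
  fin_cases i <;> fin_cases j <;> simp [phiStarMatrix]

/-- The irreducible representation `Φ_* : SL(2, ℂ) → SL(3, ℂ)`. -/
def phiStar : SL(2, ℂ) →* SL(3, ℂ) where
  toFun M := ⟨phiStarMatrix (M : Matrix (Fin 2) (Fin 2) ℂ), phiStarMatrix_det M⟩
  map_one' := Subtype.ext (by simpa using phiStarMatrix_one)
  map_mul' M N := Subtype.ext (phiStarMatrix_mul M N)

end

end ShapeInvariants

/-!
Suppose `Γ = ⟨A, B⟩` is irreducible. The polarized Cayley–Hamilton identity rewrites the trace of a
word with a repeated letter through traces of shorter words, so that `tr g = tr g⁻¹` for all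
`g ∈ Γ` follows from the cyclically reduced words without repetition: up to inverting letters these
are `1`, `A`, `B`, `AB` and `[A, B]`. Since its trace determines an irreducible representation, the
inclusion of `Γ` is then isomorphic to its dual, that is, `Γ` preserves a nondegenerate bilinear
form. By Schur's lemma this form is symmetric or alternating, and an alternating form in odd
dimension is degenerate. Finally all nondegenerate quadratic forms over `ℂ` are equivalent, and the
image of `Φ_*` is the full determinant-one isometry group of `y² + 2xz`.
-/

namespace ShapeInvariants

section TraceSymmetry

open scoped commutatorElement

variable {n R : Type*} [Fintype n] [DecidableEq n] [CommRing R]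

/-- Polarized Cayley–Hamilton: this trades a repeated factor `M` for shorter products. -/
theorem mul_mul_self_eq_adjugate (M X : Matrix (Fin 3) (Fin 3) R) :
    M * X * M = -(M.adjugate * X) - X * M.adjugate + M.adjugate.trace • X
      - (X.trace * M.adjugate.trace) • (1 : Matrix (Fin 3) (Fin 3) R) + X.trace • M.adjugate
      + (M * X).trace • M + (M.adjugate * X).trace • (1 : Matrix (Fin 3) (Fin 3) R) := by
  ext i j
  simp only [Matrix.add_apply, Matrix.sub_apply, Matrix.neg_apply, Matrix.smul_apply,
    Matrix.mul_apply, Fin.sum_univ_three, Matrix.trace_fin_three, smul_eq_mul,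
    Matrix.adjugate_fin_three]
  fin_cases i <;> fin_cases j <;> simp <;> ring

theorem trace_mul_mul_mul_eq_adjugate (M X Y : Matrix (Fin 3) (Fin 3) R) :
    (M * X * M * Y).trace = -(M.adjugate * (X * Y)).trace - (M.adjugate * (Y * X)).trace
      + M.adjugate.trace * (X * Y).trace - X.trace * M.adjugate.trace * Y.trace
      + X.trace * (M.adjugate * Y).trace + (M * X).trace * (M * Y).trace
      + (M.adjugate * X).trace * Y.trace := by
  have hrot : (X * (M.adjugate * Y)).trace = (M.adjugate * (Y * X)).trace := by
    rw [Matrix.trace_mul_comm, Matrix.mul_assoc]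
  rw [mul_mul_self_eq_adjugate]
  simp only [add_mul, sub_mul, neg_mul, smul_mul_assoc, one_mul, Matrix.trace_add,
    Matrix.trace_sub, Matrix.trace_neg, Matrix.trace_smul, smul_eq_mul, Matrix.mul_assoc, hrot]

/-- The property `tr g = tr g⁻¹` of an element of a special linear group. -/
def IsTraceSymmetric (g : Matrix.SpecialLinearGroup n R) : Prop :=
  (g : Matrix n n R).trace = (↑g⁻¹ : Matrix n n R).trace

theorem trace_coe_mul_comm (g h : Matrix.SpecialLinearGroup n R) :
    (↑(g * h) : Matrix n n R).trace = (↑(h * g) : Matrix n n R).trace := by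
  rw [Matrix.SpecialLinearGroup.coe_mul, Matrix.trace_mul_comm, Matrix.SpecialLinearGroup.coe_mul]

theorem isTraceSymmetric_one : IsTraceSymmetric (1 : Matrix.SpecialLinearGroup n R) := by
  rw [IsTraceSymmetric, inv_one]

theorem IsTraceSymmetric.inv {g : Matrix.SpecialLinearGroup n R} (hg : IsTraceSymmetric g) :
    IsTraceSymmetric g⁻¹ := by
  rw [IsTraceSymmetric, inv_inv, hg]

theorem isTraceSymmetric_mul_comm {g h : Matrix.SpecialLinearGroup n R} :
    IsTraceSymmetric (g * h) ↔ IsTraceSymmetric (h * g) := by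
  rw [IsTraceSymmetric, IsTraceSymmetric, trace_coe_mul_comm g, mul_inv_rev, mul_inv_rev,
    trace_coe_mul_comm h⁻¹]

theorem isTraceSymmetric_mul_mul_mul {m x y : SL(3, R)}
    (hm : IsTraceSymmetric m) (hx : IsTraceSymmetric x) (hy : IsTraceSymmetric y)
    (hxy : IsTraceSymmetric (x * y)) (hmx : IsTraceSymmetric (m * x))
    (hmy : IsTraceSymmetric (m * y)) (hmx' : IsTraceSymmetric (m⁻¹ * x))
    (hmy' : IsTraceSymmetric (m⁻¹ * y)) (hmxy : IsTraceSymmetric (m⁻¹ * (x * y)))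
    (hmyx : IsTraceSymmetric (m⁻¹ * (y * x))) : IsTraceSymmetric (m * x * m * y) := by
  have trace_formula (a b c : SL(3, R)) :=
    trace_mul_mul_mul_eq_adjugate (a : Matrix (Fin 3) (Fin 3) R) b c
  simp only [← Matrix.SpecialLinearGroup.coe_inv,
    ← Matrix.SpecialLinearGroup.coe_mul] at trace_formula
  have hinv : (↑(m * x * m * y)⁻¹ : Matrix (Fin 3) (Fin 3) R).trace =
      (↑(m⁻¹ * x⁻¹ * m⁻¹ * y⁻¹) : Matrix (Fin 3) (Fin 3) R).trace := by
    rw [mul_inv_rev, trace_coe_mul_comm]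
    simp only [mul_inv_rev, mul_assoc]
  simp only [IsTraceSymmetric, mul_inv_rev, inv_inv] at hm hx hy hxy hmx hmy hmx' hmy' hmxy hmyx
  rw [IsTraceSymmetric, hinv, trace_formula, trace_formula, inv_inv, hm, hx, hy, hxy, hmx, hmy,
    hmx', hmy', hmxy, hmyx, trace_coe_mul_comm m (x⁻¹ * y⁻¹), trace_coe_mul_comm m (y⁻¹ * x⁻¹),
    trace_coe_mul_comm x⁻¹ y⁻¹, trace_coe_mul_comm m x⁻¹, trace_coe_mul_comm m y⁻¹,
    trace_coe_mul_comm x⁻¹ m⁻¹, trace_coe_mul_comm y⁻¹ m⁻¹]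
  ring

theorem isTraceSymmetric_prod_iff_of_isRotated {l l' : List (Matrix.SpecialLinearGroup n R)}
    (h : l ~r l') : IsTraceSymmetric l.prod ↔ IsTraceSymmetric l'.prod := by
  obtain ⟨k, rfl⟩ := h
  rw [List.rotate_eq_drop_append_take_mod, List.prod_append, isTraceSymmetric_mul_comm,
    ← List.prod_append, List.take_append_drop]

theorem exists_isRotated_of_not_nodup {α : Type*} {l : List α} (h : ¬ l.Nodup) :
    ∃ m s t, l ~r m :: s ++ m :: t := by
  classical
  obtain ⟨m, hm⟩ := List.exists_duplicate_iff_not_nodup.2 h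
  obtain ⟨u, v, rfl⟩ := List.append_of_mem hm.mem
  have hmem : m ∈ v ++ u := by
    have hcount := List.duplicate_iff_two_le_count.1 hm
    rw [List.perm_middle.count_eq, List.count_cons_self] at hcount
    exact List.perm_append_comm.mem_iff.1 (List.count_pos_iff.1 (by omega))
  obtain ⟨s, t, hst⟩ := List.append_of_mem hmem
  refine ⟨m, s, t, ?_⟩
  simpa only [List.cons_append, hst] using List.isRotated_append (l := u) (l' := m :: v)

theorem isTraceSymmetric_prod_of_repeated {S : Set SL(3, R)} (hS : ∀ x ∈ S, x⁻¹ ∈ S)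
    {m : SL(3, R)} {s t : List SL(3, R)} (hl : ∀ x ∈ m :: s ++ m :: t, x ∈ S)
    (ih : ∀ l : List SL(3, R), l.length < (m :: s ++ m :: t).length → (∀ x ∈ l, x ∈ S) →
      IsTraceSymmetric l.prod) : IsTraceSymmetric (m :: s ++ m :: t).prod := by
  simp only [List.mem_append, List.mem_cons, or_imp, forall_and, forall_eq] at hl
  obtain ⟨⟨hm, hs⟩, -, ht⟩ := hl
  have shorter (l : List SL(3, R)) (hlen : l.length < s.length + t.length + 2)
      (hsub : l ⊆ m :: m⁻¹ :: (s ++ t)) : IsTraceSymmetric l.prod := by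
    refine ih l (by simp only [List.length_append, List.length_cons]; omega) fun x hx => ?_
    obtain rfl | rfl | hx | hx : x = m ∨ x = m⁻¹ ∨ x ∈ s ∨ x ∈ t := by simpa using hsub hx
    exacts [hm, hS _ hm, hs _ hx, ht _ hx]
  rw [List.cons_append, List.prod_cons, List.prod_append, List.prod_cons, ← mul_assoc,
    ← mul_assoc]
  apply isTraceSymmetric_mul_mul_mul
  · simpa only [List.prod_singleton] using shorter [m] (by grind) (by grind)
  · exact shorter s (by grind) (by grind)
  · exact shorter t (by grind) (by grind)
  · simpa only [List.prod_append] using shorter (s ++ t) (by grind) (by grind)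
  · simpa only [List.prod_cons] using shorter (m :: s) (by grind) (by grind)
  · simpa only [List.prod_cons] using shorter (m :: t) (by grind) (by grind)
  · simpa only [List.prod_cons] using shorter (m⁻¹ :: s) (by grind) (by grind)
  · simpa only [List.prod_cons] using shorter (m⁻¹ :: t) (by grind) (by grind)
  · simpa only [List.prod_cons, List.prod_append] using
      shorter (m⁻¹ :: (s ++ t)) (by grind) (by grind)
  · simpa only [List.prod_cons, List.prod_append] using
      shorter (m⁻¹ :: (t ++ s)) (by grind) (by grind)

theorem isTraceSymmetric_prod_of_nodup {S : Set SL(3, R)} (hS : ∀ x ∈ S, x⁻¹ ∈ S)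
    (h : ∀ l : List SL(3, R), (∀ x ∈ l, x ∈ S) → l.Nodup →
      (∀ x y t, l ~r x :: y :: t → x * y ≠ 1) → IsTraceSymmetric l.prod)
    (l : List SL(3, R)) (hl : ∀ x ∈ l, x ∈ S) : IsTraceSymmetric l.prod := by
  induction hk : l.length using Nat.strong_induction_on generalizing l with
  | _ k ih =>
  subst hk
  replace ih (l' : List SL(3, R)) (hlt : l'.length < l.length) (hl' : ∀ x ∈ l', x ∈ S) :
      IsTraceSymmetric l'.prod := ih _ hlt l' hl' rfl
  by_cases hnodup : l.Nodup
  · by_cases hred : ∀ x y t, l ~r x :: y :: t → x * y ≠ 1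
    · exact h l hl hnodup hred
    push Not at hred
    obtain ⟨x, y, t, hrot, hxy⟩ := hred
    rw [isTraceSymmetric_prod_iff_of_isRotated hrot, List.prod_cons, List.prod_cons, ← mul_assoc,
      hxy, one_mul]
    refine ih t (by grind [hrot.perm.length_eq]) fun z hz => hl z (hrot.mem_iff.2 (by grind))
  · obtain ⟨m, s, t, hrot⟩ := exists_isRotated_of_not_nodup hnodup
    rw [isTraceSymmetric_prod_iff_of_isRotated hrot]
    exact isTraceSymmetric_prod_of_repeated hS (fun x hx => hl x (hrot.mem_iff.2 hx))
      fun l' hlt => ih l' (hrot.perm.length_eq ▸ hlt)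

theorem isTraceSymmetric_mul_of_mem_pair_inv {a b x y : Matrix.SpecialLinearGroup n R}
    (hab : IsTraceSymmetric (a * b)) (hab' : IsTraceSymmetric (a⁻¹ * b))
    (hx : x = a ∨ x = a⁻¹) (hy : y = b ∨ y = b⁻¹) : IsTraceSymmetric (x * y) := by
  obtain rfl | rfl := hx <;> obtain rfl | rfl := hy
  · exact hab
  · simpa only [mul_inv_rev, inv_inv] using (isTraceSymmetric_mul_comm.1 hab').inv
  · exact hab'
  · simpa only [mul_inv_rev] using (isTraceSymmetric_mul_comm.1 hab).inv

theorem IsTraceSymmetric.commutator_swap {a b : Matrix.SpecialLinearGroup n R}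
    (h : IsTraceSymmetric ⁅a, b⁆) : IsTraceSymmetric ⁅b, a⁆ := by
  simpa only [commutatorElement_inv] using h.inv

theorem IsTraceSymmetric.commutator_inv_left {a b : Matrix.SpecialLinearGroup n R}
    (h : IsTraceSymmetric ⁅a, b⁆) : IsTraceSymmetric ⁅a⁻¹, b⁆ := by
  have hconj : IsTraceSymmetric (b * a⁻¹ * b⁻¹ * a) :=
    isTraceSymmetric_mul_comm.1 (by simpa only [commutatorElement_def, mul_assoc] using h)
  simpa only [commutatorElement_def, mul_inv_rev, inv_inv, mul_assoc] using hconj.inv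

theorem isTraceSymmetric_commutator_of_mem_pair_inv {a b x y : Matrix.SpecialLinearGroup n R}
    (h : IsTraceSymmetric ⁅a, b⁆) (hx : x = a ∨ x = a⁻¹) (hy : y = b ∨ y = b⁻¹) :
    IsTraceSymmetric ⁅x, y⁆ := by
  obtain rfl | rfl := hx <;> obtain rfl | rfl := hy
  · exact h
  · exact h.commutator_swap.commutator_inv_left.commutator_swap
  · exact h.commutator_inv_left
  · exact h.commutator_inv_left.commutator_swap.commutator_inv_left.commutator_swap

theorem mul_eq_one_of_ne_of_mem_pair_inv {G : Type*} [Group G] {c u v : G} (hne : u ≠ v)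
    (hu : u = c ∨ u = c⁻¹) (hv : v = c ∨ v = c⁻¹) : u * v = 1 := by
  obtain rfl | rfl := hu <;> obtain rfl | rfl := hv
  · exact absurd rfl hne
  · exact mul_inv_cancel u
  · exact inv_mul_cancel v
  · exact absurd rfl hne

/-- The letters of a cyclically reduced word alternate between `a^±1` and `b^±1`, so a fifth letter
would repeat an earlier one. -/
theorem isTraceSymmetric_prod_cons_of_reduced {a b : SL(3, R)} (ha : IsTraceSymmetric a)
    (hab : IsTraceSymmetric (a * b)) (hab' : IsTraceSymmetric (a⁻¹ * b))
    (hcomm : IsTraceSymmetric ⁅a, b⁆) {x : SL(3, R)} {t : List SL(3, R)}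
    (hx : x = a ∨ x = a⁻¹) (ht : ∀ z ∈ t, (z = a ∨ z = a⁻¹) ∨ z = b ∨ z = b⁻¹)
    (hnodup : (x :: t).Nodup) (hred : ∀ u v s, x :: t ~r u :: v :: s → u * v ≠ 1) :
    IsTraceSymmetric (x :: t).prod := by
  obtain - | ⟨y, t⟩ := t
  · rw [List.prod_singleton]
    obtain rfl | rfl := hx
    exacts [ha, ha.inv]
  have hy : y = b ∨ y = b⁻¹ := (ht y (by simp)).resolve_left fun hy =>
    hred x y _ (.refl _) (mul_eq_one_of_ne_of_mem_pair_inv (by grind) hx hy)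
  obtain - | ⟨z, t⟩ := t
  · simpa using isTraceSymmetric_mul_of_mem_pair_inv hab hab' hx hy
  have hz : z = a ∨ z = a⁻¹ := (ht z (by simp)).resolve_right fun hz =>
    hred y z (t ++ [x]) ⟨1, by simp⟩ (mul_eq_one_of_ne_of_mem_pair_inv (by grind) hy hz)
  have hxz : x * z = 1 := mul_eq_one_of_ne_of_mem_pair_inv (by grind) hx hz
  obtain - | ⟨w, t⟩ := t
  · exact absurd (mul_eq_one_comm.1 hxz) (hred z x [y] ⟨2, by simp⟩)
  have hw : w = b ∨ w = b⁻¹ := (ht w (by simp)).resolve_left fun hw =>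
    hred z w (t ++ [x, y]) ⟨2, by simp⟩ (mul_eq_one_of_ne_of_mem_pair_inv (by grind) hz hw)
  have hyw : y * w = 1 := mul_eq_one_of_ne_of_mem_pair_inv (by grind) hy hw
  obtain - | ⟨v, t⟩ := t
  · simpa [commutatorElement_def, eq_inv_of_mul_eq_one_right hxz,
      eq_inv_of_mul_eq_one_right hyw, mul_assoc] using
      isTraceSymmetric_commutator_of_mem_pair_inv hcomm hx hy
  obtain hv | hv := ht v (by simp)
  · have hxv : x * v = 1 := mul_eq_one_of_ne_of_mem_pair_inv (by grind) hx hv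
    exact absurd (mul_left_cancel (hxz.trans hxv.symm)) (by grind)
  · have hyv : y * v = 1 := mul_eq_one_of_ne_of_mem_pair_inv (by grind) hy hv
    exact absurd (mul_left_cancel (hyw.trans hyv.symm)) (by grind)

theorem isTraceSymmetric_of_mem_closure_pair {a b g : SL(3, R)} (ha : IsTraceSymmetric a)
    (hb : IsTraceSymmetric b) (hab : IsTraceSymmetric (a * b))
    (hab' : IsTraceSymmetric (a⁻¹ * b)) (hcomm : IsTraceSymmetric ⁅a, b⁆)
    (hg : g ∈ Subgroup.closure {a, b}) : IsTraceSymmetric g := by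
  have hba' : IsTraceSymmetric (b⁻¹ * a) := by
    simpa only [mul_inv_rev, inv_inv] using hab'.inv
  rw [← Subgroup.mem_toSubmonoid, Subgroup.closure_toSubmonoid] at hg
  obtain ⟨l, hl, rfl⟩ := Submonoid.exists_list_of_mem_closure hg
  refine isTraceSymmetric_prod_of_nodup (fun x hx => hx.symm.imp id Set.inv_mem_inv.2)
    (fun l hl hnodup hred => ?_) l hl
  obtain - | ⟨x, t⟩ := l
  · exact isTraceSymmetric_one
  have hletter : ∀ z ∈ x :: t, (z = a ∨ z = a⁻¹) ∨ z = b ∨ z = b⁻¹ := fun z hz => by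
    simpa only [Set.mem_union, Set.mem_inv, Set.mem_insert_iff, Set.mem_singleton_iff,
      inv_eq_iff_eq_inv, or_or_or_comm] using hl z hz
  obtain hx | hx := hletter x (by simp)
  · exact isTraceSymmetric_prod_cons_of_reduced ha hab hab' hcomm hx
      (fun z hz => hletter z (by simp [hz])) hnodup hred
  · exact isTraceSymmetric_prod_cons_of_reduced hb (isTraceSymmetric_mul_comm.1 hab) hba'
      hcomm.commutator_swap hx (fun z hz => (hletter z (by simp [hz])).symm) hnodup hred

end TraceSymmetry

section Burnside

variable {k V : Type*} [Field k] [IsAlgClosed k]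

/-- Burnside's theorem, by the density theorem and Schur's lemma. -/
theorem subalgebra_eq_top_of_irreducible [AddCommGroup V] [Module k V] [FiniteDimensional k V]
    [Nontrivial V] (A : Subalgebra k (Module.End k V))
    (hA : ∀ W : Submodule k V, (∀ f ∈ A, ∀ v ∈ W, f v ∈ W) → W = ⊥ ∨ W = ⊤) : A = ⊤ := by
  have : IsSimpleModule A V := isSimpleModule_iff _ _ |>.2 ⟨fun W =>
    (hA (W.restrictScalars k) fun f hf v hv => W.smul_mem ⟨f, hf⟩ hv).imp
      (Submodule.restrictScalars_eq_bot_iff _ _ _).1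
      (Submodule.restrictScalars_eq_top_iff _ _ _).1⟩
  have schur := (IsSimpleModule.algebraMap_end_bijective_of_isAlgClosed (A := A) (V := V) k).2
  have : IsScalarTower k (Module.End A V) V := ⟨fun _ _ _ => rfl⟩
  have : Module.Finite (Module.End A V) V := Module.Finite.of_restrictScalars_finite k _ _
  refine eq_top_iff.2 fun f _ => ?_
  let F : Module.End (Module.End A V) V :=
    { toFun := f
      map_add' := map_add f
      map_smul' := fun c v => by
        obtain ⟨a, rfl⟩ := schur c
        exact map_smul f a v }
  obtain ⟨a, ha⟩ := Module.Finite.toModuleEnd_moduleEnd_surjective (R := A) (M := V) F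
  have haf : (a : Module.End k V) = f := LinearMap.ext fun v => LinearMap.congr_fun ha v
  exact haf ▸ a.2

theorem span_range_eq_top_of_irreducible {G n : Type*} [Monoid G] [Fintype n] [DecidableEq n]
    [Nonempty n] (ρ : G →* Matrix n n k)
    (h : ∀ W : Submodule k (n → k), (∀ g, ∀ v ∈ W, ρ g *ᵥ v ∈ W) → W = ⊥ ∨ W = ⊤) :
    Submodule.span k (Set.range ρ) = ⊤ := by
  let e : Matrix n n k ≃ₐ[k] Module.End k (n → k) := Matrix.toLinAlgEquiv'
  have himage : (Algebra.adjoin k (Set.range ρ)).map (e : Matrix n n k →ₐ[k] _) = ⊤ :=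
    subalgebra_eq_top_of_irreducible _ fun W hW =>
      h W fun g => hW _ ⟨ρ g, Algebra.subset_adjoin ⟨g, rfl⟩, rfl⟩
  have hadjoin : Algebra.adjoin k (Set.range ρ) = ⊤ := by
    refine eq_top_iff.2 fun M _ => ?_
    obtain ⟨N, hN, hNM⟩ := himage ▸ Algebra.mem_top (x := e M)
    exact e.injective hNM ▸ hN
  have hclosure : (Submonoid.closure (Set.range ρ) : Set (Matrix n n k)) = Set.range ρ := by
    rw [← MonoidHom.coe_mrange, Submonoid.closure_eq]
  rw [← hclosure, ← Algebra.adjoin_eq_span, hadjoin, Algebra.top_toSubmodule]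

end Burnside

theorem exists_comp_eq_of_ker_le_ker {k U V W : Type*} [Field k] [AddCommGroup U] [Module k U]
    [AddCommGroup V] [Module k V] [AddCommGroup W] [Module k W] {f : U →ₗ[k] V} {g : U →ₗ[k] W}
    (h : LinearMap.ker g ≤ LinearMap.ker f) : ∃ L : W →ₗ[k] V, L ∘ₗ g = f := by
  obtain ⟨s, hs⟩ := LinearMap.exists_leftInverse_of_injective
    ((LinearMap.ker g).liftQ g le_rfl) (Submodule.ker_liftQ_eq_bot _ _ _ le_rfl)
  refine ⟨(LinearMap.ker g).liftQ f h ∘ₗ s, LinearMap.ext fun x => ?_⟩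
  have hsx : s (g x) = (LinearMap.ker g).mkQ x :=
    LinearMap.congr_fun hs ((LinearMap.ker g).mkQ x)
  rw [LinearMap.comp_apply, LinearMap.comp_apply, hsx, Submodule.mkQ_apply,
    Submodule.liftQ_apply]

section Characters

variable {k G n : Type*} [Field k] [Monoid G] [Fintype n] [DecidableEq n]

theorem lift_surjective_of_span_eq_top {ρ : G →* Matrix n n k}
    (h : Submodule.span k (Set.range ρ) = ⊤) :
    Function.Surjective (MonoidAlgebra.lift k (Matrix n n k) G ρ) := by
  rw [← AlgHom.coe_toLinearMap, ← LinearMap.range_eq_top, eq_top_iff, ← h, Submodule.span_le]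
  rintro _ ⟨g, rfl⟩
  exact ⟨MonoidAlgebra.of k G g, by simp⟩

theorem trace_lift_eq {ρ ρ' : G →* Matrix n n k} (h : ∀ g, (ρ g).trace = (ρ' g).trace)
    (x : MonoidAlgebra k G) :
    (MonoidAlgebra.lift k (Matrix n n k) G ρ x).trace =
      (MonoidAlgebra.lift k (Matrix n n k) G ρ' x).trace := by
  induction x using MonoidAlgebra.induction_on with
  | of g => simp [h]
  | add x y hx hy => simp [hx, hy]
  | smul r x hx => simp [hx]

theorem lift_eq_zero_of_lift_eq_zero {ρ ρ' : G →* Matrix n n k}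
    (h : ∀ g, (ρ g).trace = (ρ' g).trace) (hρ : Submodule.span k (Set.range ρ) = ⊤)
    {x : MonoidAlgebra k G} (hx : MonoidAlgebra.lift k (Matrix n n k) G ρ' x = 0) :
    MonoidAlgebra.lift k (Matrix n n k) G ρ x = 0 := by
  rw [Matrix.ext_iff_trace_mul_right]
  intro M
  obtain ⟨y, rfl⟩ := lift_surjective_of_span_eq_top hρ M
  rw [← map_mul, trace_lift_eq h, map_mul, hx, zero_mul, zero_mul]

theorem exists_algEquiv_of_trace_eq {ρ ρ' : G →* Matrix n n k}
    (h : ∀ g, (ρ g).trace = (ρ' g).trace) (hρ : Submodule.span k (Set.range ρ) = ⊤) :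
    ∃ φ : Matrix n n k ≃ₐ[k] Matrix n n k, ∀ g, φ (ρ g) = ρ' g := by
  let f := MonoidAlgebra.lift k (Matrix n n k) G ρ
  let f' := MonoidAlgebra.lift k (Matrix n n k) G ρ'
  have hf : Function.Surjective f := lift_surjective_of_span_eq_top hρ
  have hker : LinearMap.ker f'.toLinearMap ≤ LinearMap.ker f.toLinearMap :=
    fun x hx => lift_eq_zero_of_lift_eq_zero h hρ hx
  obtain ⟨L, hL⟩ := exists_comp_eq_of_ker_le_ker hker
  have hLf (x) : L (f' x) = f x := LinearMap.congr_fun hL x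
  have hLsurj : Function.Surjective L := fun M => by
    obtain ⟨x, rfl⟩ := hf M
    exact ⟨f' x, hLf x⟩
  have hLinj : Function.Injective L := LinearMap.injective_iff_surjective.2 hLsurj
  have hf' : Function.Surjective f' := fun M => by
    obtain ⟨x, hx⟩ := hf (L M)
    exact ⟨x, hLinj (by rw [hLf, hx])⟩
  have hLone : L 1 = 1 := by simpa only [map_one] using hLf 1
  have hLmul (M N) : L (M * N) = L M * L N := by
    obtain ⟨x, rfl⟩ := hf' M
    obtain ⟨y, rfl⟩ := hf' N
    rw [← map_mul, hLf, hLf, hLf, map_mul]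
  refine ⟨(AlgEquiv.ofLinearEquiv (.ofBijective L ⟨hLinj, hLsurj⟩) hLone hLmul).symm,
    fun g => (AlgEquiv.symm_apply_eq _).2 (?_ : ρ g = L (ρ' g))⟩
  simpa [f, f'] using (hLf (MonoidAlgebra.of k G g)).symm

/-- Skolem–Noether for matrix algebras. -/
theorem exists_conj_of_algEquiv (φ : Matrix n n k ≃ₐ[k] Matrix n n k) :
    ∃ S : Matrix n n k, IsUnit S.det ∧ ∀ M, φ M * S = S * M := by
  let e : Matrix n n k ≃ₐ[k] Module.End k (n → k) := Matrix.toLinAlgEquiv'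
  obtain ⟨T, hT⟩ := ((e.symm.trans φ).trans e).eq_linearEquivConjAlgEquiv
  refine ⟨e.symm T.toLinearMap, ?_, fun M => e.injective ?_⟩
  · rw [show e.symm T.toLinearMap = LinearMap.toMatrix' T.toLinearMap from rfl,
      LinearMap.det_toMatrix']
    exact T.isUnit_det'
  · have hφ : e (φ M) = T.conjAlgEquiv k (e M) := by
      simpa using AlgEquiv.congr_fun hT (e M)
    rw [map_mul, map_mul, hφ, AlgEquiv.apply_symm_apply]
    ext v
    simp

theorem exists_conj_of_trace_eq {ρ ρ' : G →* Matrix n n k}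
    (h : ∀ g, (ρ g).trace = (ρ' g).trace) (hρ : Submodule.span k (Set.range ρ) = ⊤) :
    ∃ S : Matrix n n k, IsUnit S.det ∧ ∀ g, ρ' g * S = S * ρ g := by
  obtain ⟨φ, hφ⟩ := exists_algEquiv_of_trace_eq h hρ
  obtain ⟨S, hS, hconj⟩ := exists_conj_of_algEquiv φ
  exact ⟨S, hS, fun g => by rw [← hφ, hconj]⟩

end Characters

section InvariantForm

variable {k G n : Type*} [Field k] [Fintype n] [DecidableEq n]

theorem exists_smul_eq_of_intertwining {ρ σ : G → Matrix n n k} {S T : Matrix n n k}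
    (hρ : Submodule.span k (Set.range ρ) = ⊤) (hdet : IsUnit S.det)
    (hS : ∀ g, σ g * S = S * ρ g) (hT : ∀ g, σ g * T = T * ρ g) : ∃ c : k, T = c • S := by
  have hcomm (g : G) : Commute (ρ g) (S⁻¹ * T) := calc
    ρ g * (S⁻¹ * T) = S⁻¹ * (S * ρ g) * S⁻¹ * T := by
      rw [Matrix.nonsing_inv_mul_cancel_left _ _ hdet, Matrix.mul_assoc]
    _ = S⁻¹ * (σ g * T) := by
      rw [← hS, ← Matrix.mul_assoc, Matrix.mul_nonsing_inv_cancel_right _ _ hdet,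
        Matrix.mul_assoc]
    _ = S⁻¹ * T * ρ g := by rw [hT, Matrix.mul_assoc]
  have hcentral (M : Matrix n n k) : Commute M (S⁻¹ * T) := by
    induction (hρ ▸ Submodule.mem_top : M ∈ Submodule.span k (Set.range ρ)) using
      Submodule.span_induction with
    | mem M hM =>
      obtain ⟨g, rfl⟩ := hM
      exact hcomm g
    | zero => exact Commute.zero_left _
    | add M N _ _ hM hN => exact hM.add_left hN
    | smul a M _ hM => exact hM.smul_left a
  obtain ⟨c, hc⟩ := Matrix.mem_range_scalar_of_commute_single fun i j _ =>
    hcentral (Matrix.single i j 1)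
  refine ⟨c, ?_⟩
  rw [← Matrix.mul_nonsing_inv_cancel_left S T hdet, ← hc, Matrix.scalar_apply,
    ← Matrix.smul_one_eq_diagonal, Matrix.mul_smul, Matrix.mul_one]

/-- Transposing twice gives `c² = 1`, and taking determinants `c ^ n = 1`. -/
theorem isSymm_of_transpose_eq_smul {S : Matrix n n k} {c : k} (hn : Odd (Fintype.card n))
    (hdet : S.det ≠ 0) (h : Sᵀ = c • S) : S.IsSymm := by
  have : Nonempty n := Fintype.card_pos_iff.1 hn.pos
  have hS : S ≠ 0 := by
    rintro rfl
    exact hdet Matrix.det_zero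
  obtain ⟨m, hm⟩ := hn
  have hpow : c ^ Fintype.card n = 1 := by
    have hdet_eq := congrArg Matrix.det h
    rw [Matrix.det_transpose, Matrix.det_smul] at hdet_eq
    exact mul_right_cancel₀ hdet (hdet_eq.symm.trans (one_mul _).symm)
  have hsq : c ^ 2 = 1 := by
    have hsmul : S = c ^ 2 • S := by
      rw [sq, mul_smul, ← h, ← Matrix.transpose_smul, ← h, Matrix.transpose_transpose]
    exact smul_left_injective k hS (hsmul.symm.trans (one_smul k S).symm)
  have hc : c = 1 := by rwa [hm, pow_succ, pow_mul, hsq, one_pow, one_mul] at hpow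
  rw [Matrix.IsSymm, h, hc, one_smul]

/-- The dual of a matrix representation, `g ↦ (ρ g⁻¹)ᵀ`. -/
def contragredient {R : Type*} [CommRing R] [Group G] (ρ : G →* Matrix n n R) :
    G →* Matrix n n R where
  toFun g := (ρ g⁻¹)ᵀ
  map_one' := by rw [inv_one, map_one, Matrix.transpose_one]
  map_mul' g h := by rw [mul_inv_rev, map_mul, Matrix.transpose_mul]

theorem exists_invariant_symmetric_form [Group G] {ρ : G →* Matrix n n k}
    (hn : Odd (Fintype.card n)) (hρ : Submodule.span k (Set.range ρ) = ⊤)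
    (htrace : ∀ g, (ρ g).trace = (ρ g⁻¹).trace) :
    ∃ S : Matrix n n k, S.IsSymm ∧ S.det ≠ 0 ∧ ∀ g, (ρ g)ᵀ * S * ρ g = S := by
  obtain ⟨S, hdet, hS⟩ := exists_conj_of_trace_eq (ρ' := contragredient ρ)
    (fun g => (htrace g).trans (Matrix.trace_transpose _).symm) hρ
  have hST (g : G) : contragredient ρ g * Sᵀ = Sᵀ * ρ g := by
    simpa [contragredient] using congrArg Matrix.transpose (hS g⁻¹).symm
  obtain ⟨c, hc⟩ := exists_smul_eq_of_intertwining hρ hdet hS hST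
  refine ⟨S, isSymm_of_transpose_eq_smul hn hdet.ne_zero hc, hdet.ne_zero, fun g => ?_⟩
  calc (ρ g)ᵀ * S * ρ g = (ρ g⁻¹ * ρ g)ᵀ * S := by
        rw [Matrix.mul_assoc, ← hS, ← Matrix.mul_assoc, Matrix.transpose_mul]; rfl
    _ = S := by rw [← map_mul, inv_mul_cancel, map_one, Matrix.transpose_one, Matrix.one_mul]

end InvariantForm

section SymmetricForms

variable {K n : Type*} [Field K] [Fintype n] [DecidableEq n]

theorem associated_toQuadraticForm' [Invertible (2 : K)] {M : Matrix n n K} (hM : M.IsSymm) :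
    QuadraticMap.associated (R := K) M.toQuadraticForm' = Matrix.toLinearMap₂' K M := by
  refine QuadraticMap.associated_left_inverse _ fun x y => ?_
  rw [Matrix.toLinearMap₂'_apply', Matrix.toLinearMap₂'_apply', Matrix.dotProduct_mulVec,
    ← Matrix.mulVec_transpose, hM, dotProduct_comm]

theorem toMatrix'_toQuadraticForm' [Invertible (2 : K)] {M : Matrix n n K} (hM : M.IsSymm) :
    M.toQuadraticForm'.toMatrix' = M := by
  rw [QuadraticForm.toMatrix', associated_toQuadraticForm' hM, LinearMap.toMatrix'_toLinearMap₂']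

theorem exists_transpose_mul_mul_eq [IsAlgClosed K] [Invertible (2 : K)] {S J : Matrix n n K}
    (hS : S.IsSymm) (hJ : J.IsSymm) (hS' : S.det ≠ 0) (hJ' : J.det ≠ 0) :
    ∃ P : Matrix n n K, Pᵀ * J * P = S := by
  have hnondeg {M : Matrix n n K} (hM : M.IsSymm) (hM' : M.det ≠ 0) :
      (QuadraticMap.associated (R := K) M.toQuadraticForm').SeparatingLeft := by
    rw [associated_toQuadraticForm' hM]
    exact LinearMap.separatingLeft_toLinearMap₂'_iff_det_ne_zero.2 hM'
  obtain ⟨e⟩ := QuadraticForm.equivalent_of_isAlgClosed S.toQuadraticForm' J.toQuadraticForm'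
    (hnondeg hS hS') (hnondeg hJ hJ')
  have hcomp : J.toQuadraticForm'.comp e.toLinearEquiv.toLinearMap = S.toQuadraticForm' :=
    QuadraticMap.ext e.map_app
  have hmatrix := congrArg QuadraticForm.toMatrix' hcomp
  rw [QuadraticForm.toMatrix'_comp, toMatrix'_toQuadraticForm' hJ,
    toMatrix'_toQuadraticForm' hS] at hmatrix
  exact ⟨_, hmatrix⟩

theorem exists_specialLinearGroup_coe_eq_smul [IsAlgClosed K] [Nonempty n] {P : Matrix n n K}
    (hP : P.det ≠ 0) :
    ∃ (D : Matrix.SpecialLinearGroup n K) (c : K), (D : Matrix n n K) = c • P := by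
  obtain ⟨c, hc⟩ := IsAlgClosed.exists_pow_nat_eq P.det⁻¹ (Fintype.card_pos (α := n))
  exact ⟨⟨c • P, by rw [Matrix.det_smul, hc, inv_mul_cancel₀ hP]⟩, c, rfl⟩

end SymmetricForms

section IsometryGroup

variable {R n : Type*} [CommRing R] [Fintype n] [DecidableEq n]

/-- The Gram matrix `gᵀ S g` of the pullback along `g` of the bilinear form with Gram matrix `S`. -/
def pullbackForm (S : Matrix n n R) (g : Matrix.SpecialLinearGroup n R) : Matrix n n R :=
  (g : Matrix n n R)ᵀ * S * (g : Matrix n n R)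

theorem pullbackForm_one (S : Matrix n n R) : pullbackForm S 1 = S := by
  rw [pullbackForm, Matrix.SpecialLinearGroup.coe_one, Matrix.transpose_one, Matrix.one_mul,
    mul_one]

theorem pullbackForm_mul (S : Matrix n n R) (g h : Matrix.SpecialLinearGroup n R) :
    pullbackForm S (g * h) = pullbackForm (pullbackForm S g) h := by
  simp only [pullbackForm, Matrix.SpecialLinearGroup.coe_mul, Matrix.transpose_mul, mul_assoc]

theorem pullbackForm_smul (c : R) (S : Matrix n n R) (g : Matrix.SpecialLinearGroup n R) :
    pullbackForm (c • S) g = c • pullbackForm S g := by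
  rw [pullbackForm, pullbackForm, Matrix.mul_smul, Matrix.smul_mul]

/-- The determinant-one isometry group of the bilinear form with Gram matrix `S`. -/
def isometryGroup (S : Matrix n n R) : Subgroup (Matrix.SpecialLinearGroup n R) where
  carrier := {g | pullbackForm S g = S}
  mul_mem' {g h} (hg : pullbackForm S g = S) (hh : pullbackForm S h = S) :=
    (pullbackForm_mul S g h).trans (by rw [hg, hh])
  one_mem' := pullbackForm_one S
  inv_mem' {g} (hg : pullbackForm S g = S) := calc
    pullbackForm S g⁻¹ = pullbackForm (pullbackForm S g) g⁻¹ := by rw [hg]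
    _ = S := by rw [← pullbackForm_mul, mul_inv_cancel, pullbackForm_one]

theorem mem_isometryGroup {S : Matrix n n R} {g : Matrix.SpecialLinearGroup n R} :
    g ∈ isometryGroup S ↔ pullbackForm S g = S :=
  Iff.rfl

theorem conj_mem_isometryGroup {S J : Matrix n n R} {D g : Matrix.SpecialLinearGroup n R} {c : R}
    (hD : pullbackForm J D = c • S) (hg : g ∈ isometryGroup S) :
    D * g * D⁻¹ ∈ isometryGroup J := by
  have hDg : pullbackForm J (D * g) = pullbackForm J D := by
    rw [pullbackForm_mul, hD, pullbackForm_smul, mem_isometryGroup.1 hg]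
  rw [mem_isometryGroup, pullbackForm_mul, hDg, ← pullbackForm_mul, mul_inv_cancel,
    pullbackForm_one]

end IsometryGroup

section OrthogonalGroup

/-- The Gram matrix of the quadratic form `y² + 2xz`, which the image of `Φ_*` preserves. -/
def formMatrix : Matrix (Fin 3) (Fin 3) ℂ :=
  !![0, 0, 1; 0, 1, 0; 1, 0, 0]

theorem formMatrix_det : formMatrix.det = -1 := by
  simp [formMatrix, Matrix.det_fin_three]

theorem formMatrix_isSymm : formMatrix.IsSymm := by
  ext i j
  fin_cases i <;> fin_cases j <;> rfl

theorem pullbackForm_formMatrix_apply (g : SL(3, ℂ)) (i j : Fin 3) :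
    pullbackForm formMatrix g i j = g 2 i * g 0 j + g 1 i * g 1 j + g 0 i * g 2 j := by
  simp [pullbackForm, formMatrix, Matrix.mul_apply, Fin.sum_univ_three]

theorem phiStar_coe (N : SL(2, ℂ)) :
    (phiStar N : Matrix (Fin 3) (Fin 3) ℂ) = phiStarMatrix (N : Matrix (Fin 2) (Fin 2) ℂ) :=
  rfl

theorem phiStar_mem_isometryGroup (N : SL(2, ℂ)) : phiStar N ∈ isometryGroup formMatrix := by
  have hdet := N.det_coe
  rw [Matrix.det_fin_two] at hdet
  have hs := sqrt_two_mul_self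
  ext i j
  rw [pullbackForm_formMatrix_apply]
  fin_cases i <;> fin_cases j <;>
    simp [phiStar_coe, phiStarMatrix, formMatrix] <;>
    grind

theorem exists_isotropic_parametrization {p q r : ℂ} (h : q ^ 2 + 2 * p * r = 0) :
    ∃ a c : ℂ, a ^ 2 = p ∧ -(((Real.sqrt 2 : ℝ) : ℂ) * a * c) = q ∧ -c ^ 2 = r := by
  have hs := sqrt_two_mul_self
  generalize ((Real.sqrt 2 : ℝ) : ℂ) = s at *
  obtain rfl | hp := eq_or_ne p 0
  · obtain ⟨c, hc⟩ := IsAlgClosed.exists_pow_nat_eq (-r) two_pos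
    have hq : q = 0 := by simpa using h
    exact ⟨0, c, by simp, by simp [hq], by simp [hc]⟩
  · obtain ⟨a, rfl⟩ := IsAlgClosed.exists_pow_nat_eq p two_pos
    have hs0 : s ≠ 0 := by
      rintro rfl
      simp at hs
    have ha : a ≠ 0 := ne_zero_pow two_ne_zero hp
    refine ⟨a, -q / (s * a), rfl, by field_simp, ?_⟩
    have hsa : (s * a) ^ 2 = 2 * a ^ 2 := by linear_combination a ^ 2 * hs
    rw [div_pow, hsa]
    field_simp
    linear_combination -h

/-- The image of `Φ_*` acts transitively on the nonzero isotropic vectors. -/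
theorem exists_phiStar_col_zero_eq {v : Fin 3 → ℂ} (hv : v ≠ 0) (h : v 1 ^ 2 + 2 * v 0 * v 2 = 0) :
    ∃ N : SL(2, ℂ), ∀ i, phiStar N i 0 = v i := by
  obtain ⟨a, c, ha, hac, hc⟩ := exists_isotropic_parametrization h
  have hcoprime : IsCoprime a c := by
    rw [Semifield.isCoprime_iff]
    by_contra! h0
    refine hv (funext fun i => ?_)
    fin_cases i <;> simp [← ha, ← hac, ← hc, h0]
  obtain ⟨N, hNa, hNc⟩ := hcoprime.exists_SL2_col 0
  refine ⟨N, fun i => ?_⟩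
  rw [phiStar_coe]
  fin_cases i <;> simp [phiStarMatrix, hNa, hNc, ha, hac, hc]

theorem mem_range_phiStar_of_fixes {g : SL(3, ℂ)} (hg : g ∈ isometryGroup formMatrix)
    (hcol : ∀ i, g i 0 = (1 : SL(3, ℂ)) i 0) : g ∈ phiStar.range := by
  have h00 : g 0 0 = 1 := by simpa using hcol 0
  have h10 : g 1 0 = 0 := by simpa using hcol 1
  have h20 : g 2 0 = 0 := by simpa using hcol 2
  have entry (i j : Fin 3) :
      g 2 i * g 0 j + g 1 i * g 1 j + g 0 i * g 2 j = formMatrix i j := by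
    rw [← pullbackForm_formMatrix_apply, mem_isometryGroup.1 hg]
  have h21 : g 2 1 = 0 := by simpa [formMatrix, h00, h10, h20] using entry 0 1
  have h22 : g 2 2 = 1 := by simpa [formMatrix, h00, h10, h20] using entry 0 2
  have h11 : g 1 1 = 1 := by
    have hdet := g.det_coe
    rw [Matrix.det_fin_three] at hdet
    simpa [h00, h10, h20, h21, h22] using hdet
  have h12 : g 1 2 + g 0 1 = 0 := by simpa [formMatrix, h11, h21, h22] using entry 1 2
  have h02 : g 0 2 + g 1 2 * g 1 2 + g 0 2 = 0 := by
    simpa [formMatrix, h22] using entry 2 2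
  have hs := sqrt_two_mul_self
  let N : SL(2, ℂ) := ⟨!![1, -((Real.sqrt 2 : ℝ) : ℂ) / 2 * g 0 1; 0, 1], by simp⟩
  refine ⟨N, Matrix.SpecialLinearGroup.ext _ _ fun i j => ?_⟩
  rw [phiStar_coe]
  fin_cases i <;> fin_cases j <;>
    simp [N, phiStarMatrix, h00, h10, h20, h21, h22, h11] <;>
    grind

theorem isometryGroup_formMatrix_le_range_phiStar :
    isometryGroup formMatrix ≤ phiStar.range := by
  intro g hg
  have hisotropic : g 1 0 ^ 2 + 2 * g 0 0 * g 2 0 = 0 := by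
    have h := pullbackForm_formMatrix_apply g 0 0
    rw [mem_isometryGroup.1 hg] at h
    simp only [formMatrix, Matrix.of_apply, Matrix.cons_val] at h
    linear_combination -h
  have hne : (fun i => g i 0) ≠ 0 := fun h => by
    have hdet := g.det_coe
    rw [Matrix.det_eq_zero_of_column_eq_zero 0 (congrFun h)] at hdet
    exact zero_ne_one hdet
  obtain ⟨N, hN⟩ := exists_phiStar_col_zero_eq hne hisotropic
  have hcol (i : Fin 3) : ((phiStar N)⁻¹ * g) i 0 = (1 : SL(3, ℂ)) i 0 := by
    rw [← inv_mul_cancel (phiStar N), Matrix.SpecialLinearGroup.coe_mul,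
      Matrix.SpecialLinearGroup.coe_mul, Matrix.mul_apply, Matrix.mul_apply]
    simp only [hN]
  have hmem := mem_range_phiStar_of_fixes
    (mul_mem (inv_mem (phiStar_mem_isometryGroup N)) hg) hcol
  exact (Subgroup.mul_mem_cancel_left _ (inv_mem (MonoidHom.mem_range.2 ⟨N, rfl⟩))).1 hmem

theorem exists_conj_mem_range_phiStar {S : Matrix (Fin 3) (Fin 3) ℂ} (hS : S.IsSymm)
    (hdet : S.det ≠ 0) :
    ∃ D : SL(3, ℂ), ∀ g ∈ isometryGroup S, D * g * D⁻¹ ∈ phiStar.range := by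
  obtain ⟨P, hP⟩ := exists_transpose_mul_mul_eq hS formMatrix_isSymm hdet
    (formMatrix_det ▸ neg_ne_zero.2 one_ne_zero)
  have hPdet : P.det ≠ 0 := fun h => hdet (by rw [← hP, Matrix.det_mul, h, mul_zero])
  obtain ⟨D, c, hD⟩ := exists_specialLinearGroup_coe_eq_smul hPdet
  have hpull : pullbackForm formMatrix D = (c * c) • S := by
    simp only [pullbackForm, hD, Matrix.transpose_smul, Matrix.smul_mul, Matrix.mul_smul, hP,
      smul_smul]
  exact ⟨D, fun g hg =>
    isometryGroup_formMatrix_le_range_phiStar (conj_mem_isometryGroup hpull hg)⟩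

theorem exists_conj_mem_range_phiStar_of_isTraceSymmetric {Γ : Subgroup SL(3, ℂ)}
    (hΓ : ¬ IsReducible Γ) (htrace : ∀ g ∈ Γ, IsTraceSymmetric g) :
    ∃ D : SL(3, ℂ), ∀ g ∈ Γ, D * g * D⁻¹ ∈ phiStar.range := by
  let ρ : Γ →* Matrix (Fin 3) (Fin 3) ℂ :=
    Matrix.SpecialLinearGroup.coeMonoidHom.comp Γ.subtype
  have hspan : Submodule.span ℂ (Set.range ρ) = ⊤ :=
    span_range_eq_top_of_irreducible ρ fun W hW => by
      by_contra! hne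
      exact hΓ ⟨W, hne.1, hne.2, fun g hg => hW ⟨g, hg⟩⟩
  obtain ⟨S, hS, hdet, hinv⟩ :=
    exists_invariant_symmetric_form (by decide) hspan fun g => htrace g g.2
  obtain ⟨D, hD⟩ := exists_conj_mem_range_phiStar hS hdet
  exact ⟨D, fun g hg => hD g (hinv ⟨g, hg⟩)⟩

end OrthogonalGroup

theorem isTraceSymmetric_inv_mul_of_shapePlus_eq_shapeMinus {A B C : SL(3, ℂ)}
    (hA : IsTraceSymmetric A) (hB : IsTraceSymmetric B)
    (h : shapePlus A B C = shapeMinus A B C) : IsTraceSymmetric (A⁻¹ * B) := by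
  change tr A = tr A⁻¹ at hA
  change tr B = tr B⁻¹ at hB
  change tr (A⁻¹ * B) = tr (A⁻¹ * B)⁻¹
  rw [mul_inv_rev, inv_inv]
  rw [shapePlus, shapeMinus] at h
  linear_combination h - tr B * hA + tr A * hB

end ShapeInvariants

theorem corollary5p9 (A B C : SL(3, ℂ)) (hCBA : C * B * A = 1)
    (hA : ShapeInvariants.tr A = ShapeInvariants.tr A⁻¹)
    (hB : ShapeInvariants.tr B = ShapeInvariants.tr B⁻¹)
    (hC : ShapeInvariants.tr C = ShapeInvariants.tr C⁻¹)
    (hσ : ShapeInvariants.shapePlus A B C = ShapeInvariants.shapeMinus A B C)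
    (hcomm : ShapeInvariants.tr (A * B * A⁻¹ * B⁻¹) =
      ShapeInvariants.tr (A * B * A⁻¹ * B⁻¹)⁻¹) :
    ShapeInvariants.IsReducible (Subgroup.closure {A, B, C}) ∨
      ∃ D : SL(3, ℂ), ∀ g ∈ Subgroup.closure {A, B, C},
        D * g * D⁻¹ ∈ ShapeInvariants.phiStar.range := by
  refine or_iff_not_imp_left.2 fun hirr =>
    ShapeInvariants.exists_conj_mem_range_phiStar_of_isTraceSymmetric hirr fun g hg => ?_
  have hCinv : C⁻¹ = B * A := inv_eq_of_mul_eq_one_right (by rw [← mul_assoc, hCBA])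
  have hclosure : Subgroup.closure {A, B, C} ≤ Subgroup.closure {A, B} := by
    rw [Subgroup.closure_le]
    rintro _ (rfl | rfl | rfl)
    · exact Subgroup.subset_closure (by simp)
    · exact Subgroup.subset_closure (by simp)
    · rw [SetLike.mem_coe, ← inv_mem_iff, hCinv]
      exact mul_mem (Subgroup.subset_closure (by simp)) (Subgroup.subset_closure (by simp))
  have hBA : ShapeInvariants.IsTraceSymmetric (B * A) :=
    hCinv ▸ ShapeInvariants.IsTraceSymmetric.inv hC
  exact ShapeInvariants.isTraceSymmetric_of_mem_closure_pair hA hB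
    (ShapeInvariants.isTraceSymmetric_mul_comm.1 hBA)
    (ShapeInvariants.isTraceSymmetric_inv_mul_of_shapePlus_eq_shapeMinus hA hB hσ)
    hcomm (hclosure hg)
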